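/- **Proposition (totally geodesic submersions).** Let $(M,g)$ and $(N,h)$ be smooth finite-dimensional Riemannian manifolds without boundary, $m=\dim M$, and let $\varphi : M \to N$ be a smooth submersion, that is, a smooth map whose differential $d\varphi_x : T_xM \to T_{\varphi(x)}N$ is surjective at every $x \in M$. Let $\nabla^M$ be the Levi-Civita connection of $g$ and $\nabla^\varphi$ the connection on $\varphi^{-1}TN$ induced by the Levi-Civita connection of $h$. Then $\varphi$ is totally geodesic, i.e. its second fundamental form $$(\nabla d\varphi)(X,Y) = \nabla^{\varphi}_X\big(d\varphi(Y)\big) - d\varphi\big(\nabla^M_X Y\big)$$ vanishes identically, if and only if its first fundamental form $\varphi^*h$, given by $\varphi^*h(X,Y) = h(d\varphi(X),d\varphi(Y))$, is parallel, i.e. for all vector fields $X,Y,Z$ on $M$ $$(\nabla_X \varphi^*h)(Y,Z) = X\big(\varphi^*h(Y,Z)\big) - \varphi^*h(\nabla^M_X Y,Z) - \varphi^*h(Y,\nabla^M_X Z) = 0 .$$ Consequently, if the submersion $\varphi$ is totally geodesic, then the eigenvalues of $\varphi^*h$ with respect to $g$, listed in decreasing order with multiplicity as $\lambda_1^2(x)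 \ge \dots \ge \lambda_m^2(x)$, $x\in M$, are constant on each connected component of $M$ (hence constant when $M$ is connected). -/

import Mathlib

open Bundle Manifold
open scoped ContDiff

noncomputable section

namespace RiemannianMaps

section TangentSpaces

variable {E : Type*} [NormedAddCommGroup E] [NormedSpace ℝ E]
  {H : Type*} [TopologicalSpace H] {I : ModelWithCorners ℝ E H}
  {M : Type*} [TopologicalSpace M] [ChartedSpace H M]

theorem finrank_tangentSpace (x : M) :
    Module.finrank ℝ (TangentSpace I x) = Module.finrank ℝ E := rfl

instance finiteDimensional_tangentSpace [FiniteDimensional ℝ E] (x : M) :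
    FiniteDimensional ℝ (TangentSpace I x) :=
  inferInstanceAs (FiniteDimensional ℝ E)

instance completeSpace_tangentSpace [FiniteDimensional ℝ E]
    [RiemannianBundle (fun x : M ↦ TangentSpace I x)] (x : M) :
    CompleteSpace (TangentSpace I x) :=
  FiniteDimensional.complete ℝ _

end TangentSpaces

/-! ### The Levi-Civita connection -/

section LeviCivita

variable {E : Type*} [NormedAddCommGroup E] [NormedSpace ℝ E]
  {H : Type*} [TopologicalSpace H] (I : ModelWithCorners ℝ E H)
  {M : Type*} [TopologicalSpace M] [ChartedSpace H M]

theorem mvfderiv_congr {V : Type*} [NormedAddCommGroup V] [NormedSpace ℝ V] {f f' : M → V} {x : M}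
    (h : ∀ᶠ y in nhds x, f y = f' y) : mvfderiv I f x = mvfderiv I f' x := by
  ext v
  simp only [mvfderiv, ContinuousLinearMap.comp_apply, Filter.EventuallyEq.mfderiv_eq h]
  rfl

variable [IsManifold I ∞ M]

theorem extend_add (x : M) (w w' : TangentSpace I x) :
    ∀ᶠ y in nhds x, FiberBundle.extend E (w + w') y =
      FiberBundle.extend E w y + FiberBundle.extend E w' y := by
  have h := FiberBundle.mem_baseSet_trivializationAt E (TangentSpace I : M → Type _) x
  have e := (trivializationAt E (TangentSpace I : M → Type _) x).linear ℝ h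
  filter_upwards [(trivializationAt E (TangentSpace I : M → Type _) x).open_baseSet.mem_nhds h]
    with y hy
  simp only [FiberBundle.extend]
  simp only [e.map_add, ← Trivialization.symmL_apply (R := ℝ) _ hy, map_add]

theorem extend_smul (x : M) (c : ℝ) (w : TangentSpace I x) :
    ∀ᶠ y in nhds x, FiberBundle.extend E (c • w) y = c • FiberBundle.extend E w y := by
  have h := FiberBundle.mem_baseSet_trivializationAt E (TangentSpace I : M → Type _) x
  have e := (trivializationAt E (TangentSpace I : M → Type _) x).linear ℝ h
  filter_upwards [(trivializationAt E (TangentSpace I : M → Type _) x).open_baseSet.mem_nhds h]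
    with y hy
  simp only [FiberBundle.extend]
  simp only [e.map_smul, ← Trivialization.symmL_apply (R := ℝ) _ hy, map_smul]

variable [RiemannianBundle (fun x : M ↦ TangentSpace I x)]

/-- `metricDeriv I x v w z` is the derivative `∂_v g(W, Z)` at `x`, where `W`, `Z` are the vector
fields with values `w`, `z` at `x` and with constant coordinates in the preferred chart at `x`
(`FiberBundle.extend` extends a tangent vector with constant coordinates in that chart). -/
def metricDeriv (x : M) (v w z : TangentSpace I x) : ℝ :=
  mvfderiv I
    (fun y : M ↦ (inner ℝ (FiberBundle.extend E w y) (FiberBundle.extend E z y) : ℝ)) x v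

theorem metricDeriv_add₁ (x : M) (v v' w z : TangentSpace I x) :
    metricDeriv I x (v + v') w z = metricDeriv I x v w z + metricDeriv I x v' w z :=
  map_add _ _ _

theorem metricDeriv_smul₁ (x : M) (c : ℝ) (v w z : TangentSpace I x) :
    metricDeriv I x (c • v) w z = c * metricDeriv I x v w z :=
  map_smul (mvfderiv I _ x) c v

theorem metricDeriv_comm (x : M) (v w z : TangentSpace I x) :
    metricDeriv I x v w z = metricDeriv I x v z w := by
  simp only [metricDeriv, real_inner_comm]

variable [IsContMDiffRiemannianBundle I ∞ E (fun x : M ↦ TangentSpace I x)]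

theorem mdifferentiableAt_inner_extend (x : M) (w z : TangentSpace I x) :
    MDifferentiableAt I 𝓘(ℝ) (fun y : M ↦
      (inner ℝ (FiberBundle.extend E w y) (FiberBundle.extend E z y) : ℝ)) x :=
  MDifferentiableAt.inner_bundle (IB := I) (F := E) (E := fun x : M ↦ TangentSpace I x) (b := id)
    (FiberBundle.mdifferentiableAt_extend I E w) (FiberBundle.mdifferentiableAt_extend I E z)

theorem metricDeriv_add₂ (x : M) (v w w' z : TangentSpace I x) :
    metricDeriv I x v (w + w') z = metricDeriv I x v w z + metricDeriv I x v w' z := by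
  have h : ∀ᶠ y in nhds x, (inner ℝ (FiberBundle.extend E (w + w') y) (FiberBundle.extend E z y) : ℝ)
      = inner ℝ (FiberBundle.extend E w y) (FiberBundle.extend E z y) +
        inner ℝ (FiberBundle.extend E w' y) (FiberBundle.extend E z y) := by
    filter_upwards [extend_add I x w w'] with y hy
    rw [hy, inner_add_left]
  rw [metricDeriv, mvfderiv_congr I h, mvfderiv_fun_add (mdifferentiableAt_inner_extend I x w z)
    (mdifferentiableAt_inner_extend I x w' z)]
  rfl

theorem metricDeriv_smul₂ (x : M) (c : ℝ) (v w z : TangentSpace I x) :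
    metricDeriv I x v (c • w) z = c * metricDeriv I x v w z := by
  have h : ∀ᶠ y in nhds x, (inner ℝ (FiberBundle.extend E (c • w) y) (FiberBundle.extend E z y) : ℝ)
      = c * inner ℝ (FiberBundle.extend E w y) (FiberBundle.extend E z y) := by
    filter_upwards [extend_smul I x c w] with y hy
    rw [hy, real_inner_smul_left]
  rw [metricDeriv, mvfderiv_congr I h,
    mvfderiv_fun_mul mdifferentiableAt_const (mdifferentiableAt_inner_extend I x w z)]
  simp [mvfderiv_const, metricDeriv]

theorem metricDeriv_add₃ (x : M) (v w z z' : TangentSpace I x) :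
    metricDeriv I x v w (z + z') = metricDeriv I x v w z + metricDeriv I x v w z' := by
  simp only [metricDeriv_comm I x v w, metricDeriv_add₂]

theorem metricDeriv_smul₃ (x : M) (c : ℝ) (v w z : TangentSpace I x) :
    metricDeriv I x v w (c • z) = c * metricDeriv I x v w z := by
  simp only [metricDeriv_comm I x v w, metricDeriv_smul₂]

variable [FiniteDimensional ℝ E]

/-- The linear form `z ↦ (∂_v g(w, z) + ∂_w g(v, z) - ∂_z g(v, w)) / 2` on `T_x M`, that is, the
Christoffel symbol of the first kind at `x` in the preferred chart at `x`. -/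
def christoffelLower (x : M) (v w : TangentSpace I x) : TangentSpace I x →L[ℝ] ℝ :=
  LinearMap.toContinuousLinearMap
    { toFun := fun z ↦ (metricDeriv I x v w z + metricDeriv I x w v z - metricDeriv I x z v w) / 2
      map_add' := fun a b ↦ by simp only [metricDeriv_add₁, metricDeriv_add₃]; ring
      map_smul' := fun c a ↦ by
        simp only [metricDeriv_smul₁, metricDeriv_smul₃, RingHom.id_apply, smul_eq_mul]; ring }

/-- The Christoffel symbol of the second kind `Γ(v, w)` at `x`, in the preferred chart at `x`, as a
linear map in `v` for fixed `w`: the vector which represents the Christoffel symbol of the first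
kind through the metric. -/
def christoffel (x : M) (w : TangentSpace I x) : TangentSpace I x →L[ℝ] TangentSpace I x :=
  LinearMap.toContinuousLinearMap
    { toFun := fun v ↦
        (InnerProductSpace.toDual ℝ (TangentSpace I x)).symm (christoffelLower I x v w)
      map_add' := fun a b ↦ by
        refine ext_inner_right ℝ fun z ↦ ?_
        simp only [inner_add_left, InnerProductSpace.toDual_symm_apply, christoffelLower,
          LinearMap.coe_toContinuousLinearMap', LinearMap.coe_mk, AddHom.coe_mk,
          metricDeriv_add₁, metricDeriv_add₂]
        ring
      map_smul' := fun c a ↦ by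
        refine ext_inner_right ℝ fun z ↦ ?_
        simp only [inner_smul_left, InnerProductSpace.toDual_symm_apply, christoffelLower,
          LinearMap.coe_toContinuousLinearMap', LinearMap.coe_mk, AddHom.coe_mk,
          metricDeriv_smul₁, metricDeriv_smul₂, RingHom.id_apply, conj_trivial]
        ring }

theorem inner_christoffel (x : M) (v w z : TangentSpace I x) :
    inner ℝ (christoffel I x w v) z =
      (metricDeriv I x v w z + metricDeriv I x w v z - metricDeriv I x z v w) / 2 :=
  InnerProductSpace.toDual_symm_apply

theorem christoffel_add (x : M) (w w' : TangentSpace I x) :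
    christoffel I x (w + w') = christoffel I x w + christoffel I x w' := by
  ext v
  refine ext_inner_right ℝ fun z ↦ ?_
  rw [add_apply]
  simp only [inner_add_left, inner_christoffel, metricDeriv_add₁, metricDeriv_add₂,
    metricDeriv_add₃]
  ring

theorem christoffel_smul (x : M) (c : ℝ) (w : TangentSpace I x) :
    christoffel I x (c • w) = c • christoffel I x w := by
  ext v
  refine ext_inner_right ℝ fun z ↦ ?_
  rw [smul_apply]
  simp only [inner_smul_left, inner_christoffel, metricDeriv_smul₁, metricDeriv_smul₂,
    metricDeriv_smul₃, conj_trivial]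
  ring

/-- The isomorphism `E → T_x M` given by the preferred chart at `x`. -/
abbrev ofCoord (x : M) : E →L[ℝ] TangentSpace I x :=
  (trivializationAt E (TangentSpace I : M → Type _) x).symmL ℝ x

variable (M) in
/-- The Levi-Civita connection: in the preferred chart at `x`, `∇_v Y = ∂_v Y + Γ(v, Y)`. -/
def leviCivita : CovariantDerivative I E (TangentSpace I : M → Type _) where
  toFun Y x :=
    ofCoord I x ∘L
        mvfderiv I (fun y : M ↦ (trivializationAt E (TangentSpace I : M → Type _) x ⟨y, Y y⟩).2) x
      + christoffel I x (Y x)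
  isCovariantDerivativeOnUniv :=
    { add := by
        intro Y Z x hY hZ _
        rw [mdifferentiableAt_section] at hY hZ
        have h : ∀ᶠ y in nhds x,
            (trivializationAt E (TangentSpace I : M → Type _) x ⟨y, (Y + Z) y⟩).2 =
            (trivializationAt E (TangentSpace I : M → Type _) x ⟨y, Y y⟩).2 +
            (trivializationAt E (TangentSpace I : M → Type _) x ⟨y, Z y⟩).2 := by
          filter_upwards [(trivializationAt E (TangentSpace I : M → Type _) x).open_baseSet.mem_nhds
            (FiberBundle.mem_baseSet_trivializationAt E (TangentSpace I : M → Type _) x)] with y hy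
          exact ((trivializationAt E (TangentSpace I : M → Type _) x).linear ℝ hy).map_add _ _
        rw [mvfderiv_congr I h, mvfderiv_fun_add hY hZ, Pi.add_apply, christoffel_add,
          ContinuousLinearMap.comp_add]
        abel
      leibniz := by
        intro Y f x hY hf _
        rw [mdifferentiableAt_section] at hY
        have hx := FiberBundle.mem_baseSet_trivializationAt E (TangentSpace I : M → Type _) x
        have h : ∀ᶠ y in nhds x,
            (trivializationAt E (TangentSpace I : M → Type _) x ⟨y, (f • Y) y⟩).2 =
            f y • (trivializationAt E (TangentSpace I : M → Type _) x ⟨y, Y y⟩).2 := by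
          filter_upwards [(trivializationAt E (TangentSpace I : M → Type _) x).open_baseSet.mem_nhds
            hx] with y hy
          exact ((trivializationAt E (TangentSpace I : M → Type _) x).linear ℝ hy).map_smul _ _
        rw [mvfderiv_congr I h, mvfderiv_fun_smul hf hY, Pi.smul_apply', christoffel_smul]
        ext v
        have hc : ofCoord I x (trivializationAt E (TangentSpace I : M → Type _) x ⟨x, Y x⟩).2 =
            Y x :=
          (Trivialization.symmL_apply (R := ℝ) _ hx _).trans (Trivialization.symm_apply_apply_mk _ hx _)
        simp only [add_apply, smul_apply, ContinuousLinearMap.comp_apply,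
          ContinuousLinearMap.smulRight_apply, map_add, map_smul, hc]
        module }

theorem leviCivita_extend (x : M) (v w : TangentSpace I x) :
    leviCivita I M (FiberBundle.extend E w) x v = christoffel I x w v := by
  have h : ∀ᶠ y in nhds x,
      (trivializationAt E (TangentSpace I : M → Type _) x ⟨y, FiberBundle.extend E w y⟩).2 =
      (trivializationAt E (TangentSpace I : M → Type _) x ⟨x, w⟩).2 := by
    filter_upwards [(trivializationAt E (TangentSpace I : M → Type _) x).open_baseSet.mem_nhds
      (FiberBundle.mem_baseSet_trivializationAt E (TangentSpace I : M → Type _) x)] with y hy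
    rw [FiberBundle.extend, Trivialization.apply_mk_symm _ hy]
  change (ofCoord I x ∘L mvfderiv I _ x + christoffel I x (FiberBundle.extend E w x)) v = _
  rw [mvfderiv_congr I h, mvfderiv_const, FiberBundle.extend_apply_self]
  simp

/-- The Levi-Civita connection is compatible with the metric. -/
theorem isMetricCompatible_leviCivita :
    CovariantDerivative.IsMetricCompatible (F := E) (V := fun x : M ↦ TangentSpace I x)
      (leviCivita I M) := by
  unfold CovariantDerivative.IsMetricCompatible
  ext x w z v
  rw [CovariantDerivative.derivMetricTensor_apply_eq_extend]
  change metricDeriv I x v w z - inner ℝ (leviCivita I M (FiberBundle.extend E w) x v) z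
    - inner ℝ w (leviCivita I M (FiberBundle.extend E z) x v) = 0
  rw [leviCivita_extend, leviCivita_extend, inner_christoffel, real_inner_comm,
    inner_christoffel, metricDeriv_comm I x v z w, metricDeriv_comm I x z v w,
    metricDeriv_comm I x w v z]
  ring

theorem mlieBracket_extend (x : M) (v w : TangentSpace I x) :
    VectorField.mlieBracket I (FiberBundle.extend E v) (FiberBundle.extend E w) x = 0 := by
  have key (a : TangentSpace I x) : ∀ u ∈ (extChartAt I x).target,
      VectorField.mpullbackWithin 𝓘(ℝ, E) I (extChartAt I x).symm (FiberBundle.extend E a)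
        (Set.range I) u = (trivializationAt E (TangentSpace I : M → Type _) x ⟨x, a⟩).2 := by
    intro u hu
    have hs : (extChartAt I x).symm u ∈ (chartAt H x).source := by
      simpa using (extChartAt I x).map_target hu
    have h1 := TangentBundle.symmL_trivializationAt (𝕜 := ℝ) (I := I) hs
    have h2 : FiberBundle.extend E a ((extChartAt I x).symm u) =
        mfderivWithin 𝓘(ℝ, E) I (extChartAt I x).symm (Set.range I) u
          (trivializationAt E (TangentSpace I : M → Type _) x ⟨x, a⟩).2 := by
      let D : E → E → E := fun p c ↦
        mfderivWithin 𝓘(ℝ, E) I (extChartAt I x).symm (Set.range I) p c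
      have h3 := congrArg (fun p : E ↦
        D p (trivializationAt E (TangentSpace I : M → Type _) x ⟨x, a⟩).2)
        ((extChartAt I x).right_inv hu)
      have h5 := congrArg (fun L : E →L[ℝ] E ↦
        L (trivializationAt E (TangentSpace I : M → Type _) x ⟨x, a⟩).2) h1
      refine Eq.trans ?_ (h5.trans h3)
      exact (Trivialization.symmL_apply (R := ℝ) _ (by simpa using hs) _).symm
    rw [VectorField.mpullbackWithin_apply, h2]
    exact (isInvertible_mfderivWithin_extChartAt_symm hu).inverse_apply_self _
  have hev (a : TangentSpace I x) :
      VectorField.mpullbackWithin 𝓘(ℝ, E) I (extChartAt I x).symm (FiberBundle.extend E a)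
        (Set.range I) =ᶠ[nhdsWithin (extChartAt I x x) (Set.range I)]
      fun _ ↦ (trivializationAt E (TangentSpace I : M → Type _) x ⟨x, a⟩).2 :=
    Filter.mem_of_superset (extChartAt_target_mem_nhdsWithin x) (key a)
  have hx := mem_extChartAt_target (I := I) x
  rw [← VectorField.mlieBracketWithin_univ, VectorField.mlieBracketWithin_apply, Set.preimage_univ,
    Set.univ_inter,
    (hev v).lieBracketWithin_vectorField_eq (key v _ hx) (hev w) (key w _ hx)]
  simp [VectorField.lieBracketWithin]
  exact map_zero (ContinuousLinearMap.inverse (mfderiv I 𝓘(ℝ, E) (extChartAt I x) x))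

/-- The Levi-Civita connection is torsion-free. -/
theorem torsion_leviCivita : (leviCivita I M).torsion = 0 := by
  ext x v w
  rw [CovariantDerivative.torsion_apply_eq_extend, mlieBracket_extend,
    FiberBundle.extend_apply_self, FiberBundle.extend_apply_self, leviCivita_extend,
    leviCivita_extend]
  simp only [sub_zero]
  change _ = (0 : TangentSpace I x)
  rw [sub_eq_zero]
  refine ext_inner_right ℝ fun z ↦ ?_
  rw [inner_christoffel, inner_christoffel, metricDeriv_comm I x z v w]
  ring

end LeviCivita

/-! ### Maps between Riemannian manifolds -/

section Maps

variable {E : Type*} [NormedAddCommGroup E] [NormedSpace ℝ E] [FiniteDimensional ℝ E]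
  {H : Type*} [TopologicalSpace H] (I : ModelWithCorners ℝ E H)
  {M : Type*} [TopologicalSpace M] [ChartedSpace H M] [IsManifold I ∞ M]
  [RiemannianBundle (fun x : M ↦ TangentSpace I x)]
  {E' : Type*} [NormedAddCommGroup E'] [NormedSpace ℝ E'] [FiniteDimensional ℝ E']
  {H' : Type*} [TopologicalSpace H'] (J : ModelWithCorners ℝ E' H')
  {N : Type*} [TopologicalSpace N] [ChartedSpace H' N] [IsManifold J ∞ N]
  [RiemannianBundle (fun y : N ↦ TangentSpace J y)]

/-- The first fundamental form `φ^* h` of `φ : (M, g) → (N, h)`: at `x`, it is the bilinear form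
`(v, w) ↦ h(dφ v, dφ w)` on `T_x M`. -/
def firstFundamentalForm (φ : M → N) (x : M) :
    TangentSpace I x →L[ℝ] TangentSpace I x →L[ℝ] ℝ :=
  (innerSL ℝ : TangentSpace J (φ x) →L[ℝ] TangentSpace J (φ x) →L[ℝ] ℝ).bilinearComp
    (mfderiv I J φ x) (mfderiv I J φ x)

/-- The first fundamental form as an endomorphism of `T_x M`, through the musical isomorphism of
`g`: the image of `v` is the vector `A v` with `g(A v, w) = φ^* h(v, w)` for all `w`. This is
`dφ^t ∘ dφ`, where `dφ^t` is the adjoint of `dφ`. -/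
def firstFundamentalEndo (φ : M → N) (x : M) : TangentSpace I x →ₗ[ℝ] TangentSpace I x where
  toFun v := (InnerProductSpace.toDual ℝ (TangentSpace I x)).symm (firstFundamentalForm I J φ x v)
  map_add' v w := by rw [map_add, map_add]
  map_smul' c v := by
    refine ext_inner_right ℝ fun z ↦ ?_
    rw [InnerProductSpace.toDual_symm_apply, RingHom.id_apply, real_inner_smul_left,
      InnerProductSpace.toDual_symm_apply, map_smul]
    rfl

theorem inner_firstFundamentalEndo (φ : M → N) (x : M) (v w : TangentSpace I x) :
    inner ℝ (firstFundamentalEndo I J φ x v) w = firstFundamentalForm I J φ x v w :=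
  InnerProductSpace.toDual_symm_apply

theorem isSymmetric_firstFundamentalEndo (φ : M → N) (x : M) :
    (firstFundamentalEndo I J φ x).IsSymmetric := by
  intro v w
  rw [real_inner_comm _ v, inner_firstFundamentalEndo, inner_firstFundamentalEndo]
  exact real_inner_comm (F := TangentSpace J (φ x)) _ _

/-- The eigenvalues `λ_1² ≥ ⋯ ≥ λ_m²` of `φ^* h` at `x` with respect to `g`, in decreasing order and
with multiplicity, where `m = dim M`. -/
def eigenvalues (φ : M → N) (x : M) : Fin (Module.finrank ℝ E) → ℝ :=
  (isSymmetric_firstFundamentalEndo I J φ x).eigenvalues (finrank_tangentSpace x)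

/-- The value at `x`, as a linear form in the direction of differentiation, of the covariant
derivative of a covariant 2-tensor field `T` evaluated on the vector fields `Y`, `Z`:
`(∇_v T)(Y, Z) = v(T(Y, Z)) - T(∇_v Y, Z) - T(Y, ∇_v Z)`. -/
def covDerivTwoTensor [IsContMDiffRiemannianBundle I ∞ E (fun x : M ↦ TangentSpace I x)]
    (T : Π x : M, TangentSpace I x →L[ℝ] TangentSpace I x →L[ℝ] ℝ)
    (Y Z : Π x : M, TangentSpace I x) (x : M) : TangentSpace I x →L[ℝ] ℝ :=
  mvfderiv I (fun y : M ↦ T y (Y y) (Z y)) x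
    - (T x).flip (Z x) ∘L leviCivita I M Y x - T x (Y x) ∘L leviCivita I M Z x

/-- The covariant 2-tensor field `T` is parallel: `∇T = 0`. -/
def IsParallel [IsContMDiffRiemannianBundle I ∞ E (fun x : M ↦ TangentSpace I x)]
    (T : Π x : M, TangentSpace I x →L[ℝ] TangentSpace I x →L[ℝ] ℝ) : Prop :=
  ∀ (x : M) (Y Z : Π x : M, TangentSpace I x),
    MDifferentiableAt I I.tangent (fun y : M ↦ (⟨y, Y y⟩ : TangentBundle I M)) x →
    MDifferentiableAt I I.tangent (fun y : M ↦ (⟨y, Z y⟩ : TangentBundle I M)) x →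
    covDerivTwoTensor I T Y Z x = 0

variable [IsContMDiffRiemannianBundle J ∞ E' (fun y : N ↦ TangentSpace J y)]

/-- The connection `∇^φ` on `φ^{-1} TN` induced by the Levi-Civita connection of `N`: in the
preferred chart of `N` at `φ x`, `∇^φ_v s = ∂_v s + Γ(dφ v, s)`. -/
def pullbackConnection (φ : M → N) (s : Π x : M, TangentSpace J (φ x)) (x : M) :
    TangentSpace I x →L[ℝ] TangentSpace J (φ x) :=
  ofCoord J (φ x) ∘L
      mvfderiv I
        (fun y : M ↦ (trivializationAt E' (TangentSpace J : N → Type _) (φ x) ⟨φ y, s y⟩).2) x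
    + christoffel J (φ x) (s x) ∘L mfderiv I J φ x

/-- The induced connection satisfies `∇^φ_v (Y ∘ φ) = ∇_{dφ v} Y` for vector fields `Y` on `N`. -/
theorem pullbackConnection_comp (φ : M → N) (Y : Π y : N, TangentSpace J y) (x : M)
    (hφ : MDifferentiableAt I J φ x)
    (hY : MDifferentiableAt J J.tangent (fun y : N ↦ (⟨y, Y y⟩ : TangentBundle J N)) (φ x)) :
    pullbackConnection I J φ (fun y ↦ Y (φ y)) x =
      leviCivita J N Y (φ x) ∘L mfderiv I J φ x := by
  have hY' := (mdifferentiableAt_section _ Y).1 hY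
  ext v
  have h := congrArg (fun L : TangentSpace I x →L[ℝ] E' ↦ L v) (mfderiv_comp x hY' hφ)
  exact congrArg (fun e : E' ↦ ofCoord J (φ x) e +
    christoffel J (φ x) (Y (φ x)) (mfderiv I J φ x v)) h

variable [IsContMDiffRiemannianBundle I ∞ E (fun x : M ↦ TangentSpace I x)]

/-- The second fundamental form `∇dφ` of `φ`, evaluated on a vector field `Y`, as a linear map in the
direction of differentiation: `(∇dφ)(v, Y) = ∇^φ_v (dφ Y) - dφ (∇_v Y)`. -/
def secondFundamentalForm (φ : M → N) (Y : Π x : M, TangentSpace I x) (x : M) :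
    TangentSpace I x →L[ℝ] TangentSpace J (φ x) :=
  pullbackConnection I J φ (fun y ↦ mfderiv I J φ y (Y y)) x
    - mfderiv I J φ x ∘L leviCivita I M Y x

/-- The map `φ` is totally geodesic: `∇dφ = 0`. -/
def IsTotallyGeodesic (φ : M → N) : Prop :=
  ∀ (x : M) (Y : Π x : M, TangentSpace I x),
    MDifferentiableAt I I.tangent (fun y : M ↦ (⟨y, Y y⟩ : TangentBundle I M)) x →
    secondFundamentalForm I J φ Y x = 0

/-- The smooth map `φ` is a submersion: `dφ_x` is onto at each point `x`. -/
structure IsSmoothSubmersion (φ : M → N) : Prop where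
  contMDiff : ContMDiff I J ∞ φ
  surjective : ∀ x : M, Function.Surjective (mfderiv I J φ x)

end Maps

end RiemannianMaps

end

/-!
For vector fields `Y`, `Z` on `M` and a tangent vector `v`, compatibility of the induced
connection on `φ^{-1} TN` with `h` (`mvfderiv_inner_along`) gives

`(∇_v φ^* h)(Y, Z) = h((∇dφ)(v, Y), dφ Z) + h(dφ Y, (∇dφ)(v, Z))`

(`covDerivTwoTensor_firstFundamentalForm`), so `∇dφ = 0` implies `∇ φ^* h = 0`. Conversely, if
`∇ φ^* h = 0`, then `h((∇dφ)(v, w), dφ z)` is skew in `w` and `z`. It is also symmetric in `v` and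
`w`, because both connections are torsion-free (`secondFundamentalForm_extend_comm`). A trilinear
form with these two symmetries vanishes, and `dφ` is onto, so `∇dφ = 0`.

For the eigenvalues, parallel transport is avoided as follows. Along a curve, the matrices `G` and
`T` of the parallel tensors `g` and `φ^* h` in a local frame satisfy `G' = Γᵀ G + G Γ` and
`T' = Γᵀ T + T Γ`, where `Γ` is the connection matrix (`hasDerivAt_matrix_of_isParallel`). Hence the
matrix `a = G⁻¹ T` of the endomorphism satisfies `a' = a Γ - Γ a`, and the same holds for its
powers, whose traces then have derivative zero. So the power sums of the eigenvalues are locally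
constant, and the power sums determine the eigenvalues up to order
(`eq_of_antitone_of_sum_pow_eq`).
-/

namespace RiemannianMaps

/-! ### Compatibility of the induced connection with the metric -/

section Derivatives

variable {E : Type*} [NormedAddCommGroup E] [NormedSpace ℝ E]
  {H : Type*} [TopologicalSpace H] (I : ModelWithCorners ℝ E H)
  {M : Type*} [TopologicalSpace M] [ChartedSpace H M]

theorem mdifferentiableAt_and_mvfderiv_fun_sum {V ι : Type*} [NormedAddCommGroup V]
    [NormedSpace ℝ V] (s : Finset ι) {f : ι → M → V} {x : M}
    (hf : ∀ i ∈ s, MDifferentiableAt I 𝓘(ℝ, V) (f i) x) :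
    MDifferentiableAt I 𝓘(ℝ, V) (fun y ↦ ∑ i ∈ s, f i y) x ∧
      mvfderiv I (fun y ↦ ∑ i ∈ s, f i y) x = ∑ i ∈ s, mvfderiv I (f i) x := by
  classical
  induction s using Finset.induction_on with
  | empty => exact ⟨by simpa using mdifferentiableAt_const, by simp [mvfderiv_const]⟩
  | insert a s ha ih =>
    obtain ⟨h1, h2⟩ := ih fun i hi ↦ hf i (Finset.mem_insert_of_mem hi)
    have h3 := hf a (Finset.mem_insert_self a s)
    simp only [Finset.sum_insert ha]
    exact ⟨h3.add h1, by rw [mvfderiv_fun_add h3 h1, h2]⟩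

end Derivatives

section Frame

variable {E : Type*} [NormedAddCommGroup E] [NormedSpace ℝ E]
  {H : Type*} [TopologicalSpace H] (I : ModelWithCorners ℝ E H)
  {M : Type*} [TopologicalSpace M] [ChartedSpace H M] [IsManifold I ∞ M]

theorem trivializationAt_ofCoord (x : M) (a : E) :
    (trivializationAt E (TangentSpace I : M → Type _) x ⟨x, ofCoord I x a⟩).2 = a := by
  have hx := FiberBundle.mem_baseSet_trivializationAt E (TangentSpace I : M → Type _) x
  rw [Trivialization.symmL_apply (R := ℝ) _ hx, Trivialization.apply_mk_symm _ hx]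

/-- The vector fields with constant coordinates in the preferred chart at `x` form a local frame:
every tangent vector `u` at a point `y` of the chart is expanded in it with the coordinates of
`u` as coefficients. -/
theorem eq_sum_repr_smul_extend {ι : Type*} [Fintype ι] (b : Module.Basis ι ℝ E) (x : M) {y : M}
    (hy : y ∈ (trivializationAt E (TangentSpace I : M → Type _) x).baseSet)
    (u : TangentSpace I y) :
    u = ∑ i, b.repr (trivializationAt E (TangentSpace I : M → Type _) x ⟨y, u⟩).2 i •
      FiberBundle.extend E (ofCoord I x (b i)) y := by
  simp only [FiberBundle.extend, trivializationAt_ofCoord]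
  simp only [← Trivialization.symmL_apply (R := ℝ) _ hy, ← map_smul, ← map_sum, b.sum_repr]
  rw [Trivialization.symmL_apply (R := ℝ) _ hy, Trivialization.symm_apply_apply_mk _ hy]

variable [RiemannianBundle (fun x : M ↦ TangentSpace I x)]
  [IsContMDiffRiemannianBundle I ∞ E (fun x : M ↦ TangentSpace I x)] [FiniteDimensional ℝ E]

theorem metricDeriv_eq (x : M) (v w z : TangentSpace I x) :
    metricDeriv I x v w z = inner ℝ (christoffel I x w v) z + inner ℝ w (christoffel I x z v) := by
  rw [inner_christoffel, real_inner_comm, inner_christoffel,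
    metricDeriv_comm I x v z w, metricDeriv_comm I x z v w, metricDeriv_comm I x w v z]
  ring

theorem christoffel_comm (x : M) (v w : TangentSpace I x) :
    christoffel I x w v = christoffel I x v w := by
  refine ext_inner_right ℝ fun z ↦ ?_
  rw [inner_christoffel, inner_christoffel, metricDeriv_comm I x z v w]
  ring

end Frame

section Maps

variable {E : Type*} [NormedAddCommGroup E] [NormedSpace ℝ E]
  {H : Type*} [TopologicalSpace H] (I : ModelWithCorners ℝ E H)
  {M : Type*} [TopologicalSpace M] [ChartedSpace H M]
  {E' : Type*} [NormedAddCommGroup E'] [NormedSpace ℝ E'] [FiniteDimensional ℝ E']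
  {H' : Type*} [TopologicalSpace H'] (J : ModelWithCorners ℝ E' H')
  {N : Type*} [TopologicalSpace N] [ChartedSpace H' N] [IsManifold J ∞ N]
  [RiemannianBundle (fun y : N ↦ TangentSpace J y)]
  [IsContMDiffRiemannianBundle J ∞ E' (fun y : N ↦ TangentSpace J y)]

/-- The induced connection on `φ^{-1} TN` is compatible with the metric of `N`. For the proof, the
sections are expanded in the frame of vector fields on `N` with constant coordinates in the
preferred chart at `φ x`, where both sides are given by Christoffel symbols. -/
theorem mvfderiv_inner_along (φ : M → N) (x : M) (hφ : MDifferentiableAt I J φ x)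
    (s t : Π y : M, TangentSpace J (φ y))
    (hs : MDifferentiableAt I J.tangent (fun y : M ↦ (⟨φ y, s y⟩ : TangentBundle J N)) x)
    (ht : MDifferentiableAt I J.tangent (fun y : M ↦ (⟨φ y, t y⟩ : TangentBundle J N)) x)
    (v : TangentSpace I x) :
    mvfderiv I (fun y ↦ (inner ℝ (s y) (t y) : ℝ)) x v =
      inner ℝ (pullbackConnection I J φ s x v) (t x) +
        inner ℝ (s x) (pullbackConnection I J φ t x v) := by
  let b := Module.finBasis ℝ E'
  let e := trivializationAt E' (TangentSpace J : N → Type _) (φ x)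
  have hx : φ x ∈ e.baseSet :=
    FiberBundle.mem_baseSet_trivializationAt E' (TangentSpace J : N → Type _) (φ x)
  -- The frame extends the vectors `W i`; `c s i` are the coefficients of a section `s` along `φ`, and
  -- `h i j` are the coefficients of the metric.
  let W : Fin (Module.finrank ℝ E') → TangentSpace J (φ x) := fun i ↦ ofCoord J (φ x) (b i)
  let c : (Π y : M, TangentSpace J (φ y)) → Fin (Module.finrank ℝ E') → M → ℝ := fun s i y ↦
    b.repr (e ⟨φ y, s y⟩).2 i
  let h : Fin (Module.finrank ℝ E') → Fin (Module.finrank ℝ E') → N → ℝ := fun i j z ↦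
    inner ℝ (FiberBundle.extend E' (W i) z) (FiberBundle.extend E' (W j) z)
  have hcoord {s : Π y : M, TangentSpace J (φ y)}
      (hs : MDifferentiableAt I J.tangent (fun y : M ↦ (⟨φ y, s y⟩ : TangentBundle J N)) x) :
      MDifferentiableAt I 𝓘(ℝ, E') (fun y ↦ (e ⟨φ y, s y⟩).2) x := by
    exact ((mdifferentiableAt_totalSpace J (fun y : M ↦ (⟨φ y, s y⟩ : TangentBundle J N))).1 hs).2
  let L : Fin (Module.finrank ℝ E') → E' →L[ℝ] ℝ := fun i ↦
    LinearMap.toContinuousLinearMap (b.coord i)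
  have hc {s : Π y : M, TangentSpace J (φ y)}
      (hs : MDifferentiableAt I J.tangent (fun y : M ↦ (⟨φ y, s y⟩ : TangentBundle J N)) x) (i) :
      MDifferentiableAt I 𝓘(ℝ) (c s i) x ∧
        mvfderiv I (c s i) x v = b.repr (mvfderiv I (fun y ↦ (e ⟨φ y, s y⟩).2) x v) i := by
    have h1 : MDifferentiableAt 𝓘(ℝ, E') 𝓘(ℝ) (L i) (e ⟨φ x, s x⟩).2 :=
      (L i).differentiableAt.mdifferentiableAt
    refine ⟨h1.comp x (hcoord hs), ?_⟩
    have h2 := congrArg (fun A : TangentSpace I x →L[ℝ] ℝ ↦ A v)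
      (mfderiv_comp x h1 (hcoord hs))
    refine Eq.trans h2 ?_
    have h3 : mfderiv 𝓘(ℝ, E') 𝓘(ℝ) (L i) (e ⟨φ x, s x⟩).2 = L i := by
      rw [mfderiv_eq_fderiv, ContinuousLinearMap.fderiv]
    exact congrArg (fun A : E' →L[ℝ] ℝ ↦
      A (mvfderiv I (fun y ↦ (e ⟨φ y, s y⟩).2) x v)) h3
  have hh (i j) : MDifferentiableAt I 𝓘(ℝ) (fun y ↦ h i j (φ y)) x ∧
      mvfderiv I (fun y ↦ h i j (φ y)) x v =
        inner ℝ (christoffel J (φ x) (W i) (mfderiv I J φ x v)) (W j) +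
          inner ℝ (W i) (christoffel J (φ x) (W j) (mfderiv I J φ x v)) := by
    have h1 := mdifferentiableAt_inner_extend J (φ x) (W i) (W j)
    refine ⟨h1.comp x hφ, ?_⟩
    rw [← metricDeriv_eq]
    exact congrArg (fun A : TangentSpace I x →L[ℝ] ℝ ↦ A v) (mfderiv_comp x h1 hφ)
  have hexp (s : Π y : M, TangentSpace J (φ y)) {y : M} (hy : φ y ∈ e.baseSet) :
      s y = ∑ i, c s i y • FiberBundle.extend E' (W i) (φ y) :=
    eq_sum_repr_smul_extend J b (φ x) hy (s y)
  have hexpx (s : Π y : M, TangentSpace J (φ y)) : s x = ∑ i, c s i x • W i := by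
    simpa using hexp s hx
  have hpb {s : Π y : M, TangentSpace J (φ y)}
      (hs : MDifferentiableAt I J.tangent (fun y : M ↦ (⟨φ y, s y⟩ : TangentBundle J N)) x) :
      pullbackConnection I J φ s x v = ∑ i, (mvfderiv I (c s i) x v • W i +
        c s i x • christoffel J (φ x) (W i) (mfderiv I J φ x v)) := by
    have h1 : pullbackConnection I J φ s x v =
        ofCoord J (φ x) (mvfderiv I (fun y ↦ (e ⟨φ y, s y⟩).2) x v) +
          christoffel J (φ x) (s x) (mfderiv I J φ x v) := rfl
    rw [h1, Finset.sum_add_distrib]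
    congr 1
    · simp only [(hc hs _).2, W, ← map_smul, ← map_sum, b.sum_repr]
    · rw [christoffel_comm, hexpx s, map_sum]
      refine Finset.sum_congr rfl fun i _ ↦ ?_
      rw [map_smul, christoffel_comm]
  have hbil {y : N} (p q : Fin (Module.finrank ℝ E') → TangentSpace J y) :
      (inner ℝ (∑ i, p i) (∑ j, q j) : ℝ) = ∑ i, ∑ j, inner ℝ (p i) (q j) := by
    rw [sum_inner]
    exact Finset.sum_congr rfl fun i _ ↦ inner_sum _ _ _
  have hev : ∀ᶠ y in nhds x, (inner ℝ (s y) (t y) : ℝ) =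
      ∑ i, ∑ j, c s i y * (c t j y * h i j (φ y)) := by
    filter_upwards [hφ.continuousAt.preimage_mem_nhds (e.open_baseSet.mem_nhds hx)] with y hy
    rw [hexp s hy, hexp t hy, hbil]
    simp only [real_inner_smul_left, real_inner_smul_right, h]
    refine Finset.sum_congr rfl fun i _ ↦ Finset.sum_congr rfl fun j _ ↦ ?_
    ring
  have hd (i j) := (hc ht j).1.mul (hh i j).1
  have hd' (i j) := (hc hs i).1.mul (hd i j)
  have hsum (i) := mdifferentiableAt_and_mvfderiv_fun_sum I Finset.univ (fun j _ ↦ hd' i j)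
  have hmain : mvfderiv I (fun y ↦ ∑ i, ∑ j, c s i y * (c t j y * h i j (φ y))) x v =
      ∑ i, ∑ j, (c s i x * (c t j x * mvfderiv I (fun y ↦ h i j (φ y)) x v +
        h i j (φ x) * mvfderiv I (c t j) x v) +
        c t j x * h i j (φ x) * mvfderiv I (c s i) x v) := by
    have := (mdifferentiableAt_and_mvfderiv_fun_sum I Finset.univ (fun i _ ↦ (hsum i).1)).2
    refine (congrArg (fun A : TangentSpace I x →L[ℝ] ℝ ↦ A v) this).trans ?_
    rw [sum_apply]
    refine Finset.sum_congr rfl fun i _ ↦ ?_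
    rw [(hsum i).2, sum_apply]
    refine Finset.sum_congr rfl fun j _ ↦ ?_
    have h1 := mvfderiv_mul (hc hs i).1 (hd i j)
    have h2 := mvfderiv_mul (hc ht j).1 (hh i j).1
    rw [h1, h2]
    rfl
  have hhx (i j) : h i j (φ x) = inner ℝ (W i) (W j) := by
    simp only [h, FiberBundle.extend_apply_self]
  rw [mvfderiv_congr I hev, hmain, hpb hs, hpb ht, hexpx s, hexpx t]
  rw [hbil, hbil, ← Finset.sum_add_distrib]
  refine Finset.sum_congr rfl fun i _ ↦ ?_
  rw [← Finset.sum_add_distrib]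
  refine Finset.sum_congr rfl fun j _ ↦ ?_
  simp only [inner_add_left, inner_add_right, real_inner_smul_left, real_inner_smul_right,
    (hh _ _).2, hhx]
  ring

end Maps

/-! ### Second derivatives of a map in charts -/

section SecondDerivatives

variable {E : Type*} [NormedAddCommGroup E] [NormedSpace ℝ E]
  {H : Type*} [TopologicalSpace H] (I : ModelWithCorners ℝ E H)
  {M : Type*} [TopologicalSpace M] [ChartedSpace H M] [IsManifold I ∞ M]
  {E' : Type*} [NormedAddCommGroup E'] [NormedSpace ℝ E']
  {H' : Type*} [TopologicalSpace H'] (J : ModelWithCorners ℝ E' H')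
  {N : Type*} [TopologicalSpace N] [ChartedSpace H' N] [IsManifold J ∞ N]

theorem mdifferentiableAt_mfderiv_apply {φ : M → N} (hφ : ContMDiff I J ∞ φ)
    {Y : Π x : M, TangentSpace I x} {x : M}
    (hY : MDifferentiableAt I I.tangent (fun y : M ↦ (⟨y, Y y⟩ : TangentBundle I M)) x) :
    MDifferentiableAt I J.tangent
      (fun y : M ↦ (⟨φ y, mfderiv I J φ y (Y y)⟩ : TangentBundle J N)) x := by
  have h := (hφ.contMDiff_tangentMap (m := 1) (by norm_cast)).mdifferentiable one_ne_zero
  exact (h ⟨x, Y x⟩).comp x hY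

theorem trivializationAt_apply_eq_mvfderiv (x : M) {y : M} (hy : y ∈ (chartAt H x).source)
    (u : TangentSpace I y) :
    (trivializationAt E (TangentSpace I : M → Type _) x ⟨y, u⟩).2 =
      mvfderiv I (extChartAt I x) y u := by
  have hy' : y ∈ (trivializationAt E (TangentSpace I : M → Type _) x).baseSet := by simpa using hy
  exact (Trivialization.continuousLinearMapAt_apply_of_mem (R := ℝ) _ hy' u).symm.trans
    (congrArg (fun A : TangentSpace I y →L[ℝ] E ↦ A u)
      (TangentBundle.continuousLinearMapAt_trivializationAt hy))

theorem mvfderiv_extChartAt_extend (x : M) {y : M} (hy : y ∈ (chartAt H x).source)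
    (w : TangentSpace I x) :
    mvfderiv I (extChartAt I x) y (FiberBundle.extend E w y) =
      (trivializationAt E (TangentSpace I : M → Type _) x ⟨x, w⟩).2 := by
  have hy' : y ∈ (trivializationAt E (TangentSpace I : M → Type _) x).baseSet := by simpa using hy
  rw [← trivializationAt_apply_eq_mvfderiv I x hy, FiberBundle.extend,
    Trivialization.apply_mk_symm _ hy']

variable [I.Boundaryless]

/-- In charts, the differential of `φ` applied to vector fields with constant coordinates is the
derivative of the coordinate expression of `φ`, so its derivative is a second derivative, which is
symmetric. -/
theorem mvfderiv_mfderiv_extend_comm {φ : M → N} (hφ : ContMDiff I J ∞ φ) (x : M)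
    (v w : TangentSpace I x) :
    mvfderiv I (fun y : M ↦ (trivializationAt E' (TangentSpace J : N → Type _) (φ x)
        ⟨φ y, mfderiv I J φ y (FiberBundle.extend E w y)⟩).2) x v =
      mvfderiv I (fun y : M ↦ (trivializationAt E' (TangentSpace J : N → Type _) (φ x)
        ⟨φ y, mfderiv I J φ y (FiberBundle.extend E v y)⟩).2) x w := by
  -- the coordinate expression of `φ`
  let F : E → E' := extChartAt J (φ x) ∘ φ ∘ (extChartAt I x).symm
  have hF : ContDiffAt ℝ ∞ F (extChartAt I x x) := by
    have := (contMDiffAt_iff.1 (hφ x)).2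
    rwa [I.range_eq_univ, contDiffWithinAt_univ] at this
  have hsymm : IsSymmSndFDerivAt ℝ F (extChartAt I x x) :=
    hF.isSymmSndFDerivAt (by rw [minSmoothness_of_isRCLikeNormedField]; norm_cast)
  have hF' : DifferentiableAt ℝ (fderiv ℝ F) (extChartAt I x x) :=
    (hF.fderiv_right (m := 1) (by norm_cast)).differentiableAt one_ne_zero
  have hFd : ∀ᶠ u in nhds (extChartAt I x x), DifferentiableAt ℝ F u := by
    have : ContDiffAt ℝ 1 F (extChartAt I x x) := hF.of_le (by norm_cast)
    filter_upwards [this.eventually (by simp)] with u hu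
    exact hu.differentiableAt one_ne_zero
  have key (w : TangentSpace I x) : ∀ᶠ y in nhds x,
      (trivializationAt E' (TangentSpace J : N → Type _) (φ x)
        ⟨φ y, mfderiv I J φ y (FiberBundle.extend E w y)⟩).2 =
      fderiv ℝ F (extChartAt I x y)
        (trivializationAt E (TangentSpace I : M → Type _) x ⟨x, w⟩).2 := by
    have hsrc : ∀ᶠ y in nhds x, y ∈ (chartAt H x).source :=
      (chartAt H x).open_source.mem_nhds (mem_chart_source H x)
    filter_upwards [hsrc, hφ.continuous.continuousAt.preimage_mem_nhds
      ((chartAt H' (φ x)).open_source.mem_nhds (mem_chart_source H' (φ x))),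
      (continuousAt_extChartAt x).eventually hFd] with y hy hy' hyF
    rw [trivializationAt_apply_eq_mvfderiv J (φ x) hy', ← mvfderiv_extChartAt_extend I x hy w]
    have h1 := mfderiv_comp_apply y (mdifferentiableAt_extChartAt (I := J) hy')
      (hφ.mdifferentiable (by simp) y) (FiberBundle.extend E w y)
    have h2 := mfderiv_comp_apply y hyF.mdifferentiableAt (mdifferentiableAt_extChartAt (I := I) hy)
      (FiberBundle.extend E w y)
    have h3 : extChartAt J (φ x) ∘ φ =ᶠ[nhds y] F ∘ extChartAt I x := by
      filter_upwards [(chartAt H x).open_source.mem_nhds hy] with z hz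
      have : (extChartAt I x).symm (extChartAt I x z) = z :=
        (extChartAt I x).left_inv (by simpa using hz)
      simp only [F, Function.comp_apply, this]
    refine h1.symm.trans ?_
    rw [Filter.EventuallyEq.mfderiv_eq h3]
    rw [mfderiv_eq_fderiv] at h2
    exact h2
  have hext (v w : TangentSpace I x) :
      mvfderiv I (fun y : M ↦ fderiv ℝ F (extChartAt I x y)
        (trivializationAt E (TangentSpace I : M → Type _) x ⟨x, w⟩).2) x v =
      fderiv ℝ (fderiv ℝ F) (extChartAt I x x)
        (trivializationAt E (TangentSpace I : M → Type _) x ⟨x, v⟩).2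
        (trivializationAt E (TangentSpace I : M → Type _) x ⟨x, w⟩).2 := by
    have hd := hF'.clm_apply (differentiableAt_const
      (c := (trivializationAt E (TangentSpace I : M → Type _) x ⟨x, w⟩).2))
    have h2 := mfderiv_comp_apply x hd.mdifferentiableAt
      (mdifferentiableAt_extChartAt (I := I) (mem_chart_source H x)) v
    refine Eq.trans h2 ?_
    have h3 := mvfderiv_extChartAt_extend I x (mem_chart_source H x) v
    rw [FiberBundle.extend_apply_self] at h3
    rw [mfderiv_eq_fderiv, fderiv_clm_apply hF' (differentiableAt_const _), ← h3]
    simp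
    rfl
  rw [mvfderiv_congr I (key w), mvfderiv_congr I (key v), hext, hext]
  exact hsymm _ _

end SecondDerivatives

/-! ### The second fundamental form and the derivative of the first one -/

section SecondFundamentalForm

variable {E : Type*} [NormedAddCommGroup E] [NormedSpace ℝ E] [FiniteDimensional ℝ E]
  {H : Type*} [TopologicalSpace H] (I : ModelWithCorners ℝ E H)
  {M : Type*} [TopologicalSpace M] [ChartedSpace H M] [IsManifold I ∞ M]
  [RiemannianBundle (fun x : M ↦ TangentSpace I x)]
  [IsContMDiffRiemannianBundle I ∞ E (fun x : M ↦ TangentSpace I x)]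
  {E' : Type*} [NormedAddCommGroup E'] [NormedSpace ℝ E'] [FiniteDimensional ℝ E']
  {H' : Type*} [TopologicalSpace H'] (J : ModelWithCorners ℝ E' H')
  {N : Type*} [TopologicalSpace N] [ChartedSpace H' N] [IsManifold J ∞ N]
  [RiemannianBundle (fun y : N ↦ TangentSpace J y)]
  [IsContMDiffRiemannianBundle J ∞ E' (fun y : N ↦ TangentSpace J y)]

/-- The second fundamental form is symmetric: in charts it is a second derivative corrected by
Christoffel symbols, which are symmetric because both connections are torsion-free. -/
theorem secondFundamentalForm_extend_comm [I.Boundaryless] {φ : M → N} (hφ : ContMDiff I J ∞ φ)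
    (x : M) (v w : TangentSpace I x) :
    secondFundamentalForm I J φ (FiberBundle.extend E w) x v =
      secondFundamentalForm I J φ (FiberBundle.extend E v) x w := by
  have h (v w : TangentSpace I x) :
      secondFundamentalForm I J φ (FiberBundle.extend E w) x v =
        ofCoord J (φ x)
          (mvfderiv I (fun y : M ↦ (trivializationAt E' (TangentSpace J : N → Type _) (φ x)
            ⟨φ y, mfderiv I J φ y (FiberBundle.extend E w y)⟩).2) x v) +
          christoffel J (φ x) (mfderiv I J φ x w) (mfderiv I J φ x v) -
          mfderiv I J φ x (christoffel I x w v) := by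
    rw [← leviCivita_extend I]
    have : secondFundamentalForm I J φ (FiberBundle.extend E w) x v =
      ofCoord J (φ x)
          (mvfderiv I (fun y : M ↦ (trivializationAt E' (TangentSpace J : N → Type _) (φ x)
            ⟨φ y, mfderiv I J φ y (FiberBundle.extend E w y)⟩).2) x v) +
          christoffel J (φ x) (mfderiv I J φ x (FiberBundle.extend E w x)) (mfderiv I J φ x v) -
          mfderiv I J φ x (leviCivita I M (FiberBundle.extend E w) x v) := rfl
    rw [this, FiberBundle.extend_apply_self]
  rw [h, h, mvfderiv_mfderiv_extend_comm I J hφ, christoffel_comm J, christoffel_comm I]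

/-- The covariant derivative of the first fundamental form in terms of the second one:
`(∇_v φ^* h)(Y, Z) = h((∇dφ)(v, Y), dφ Z) + h(dφ Y, (∇dφ)(v, Z))`. -/
theorem covDerivTwoTensor_firstFundamentalForm {φ : M → N} (hφ : ContMDiff I J ∞ φ) {x : M}
    {Y Z : Π x : M, TangentSpace I x}
    (hY : MDifferentiableAt I I.tangent (fun y : M ↦ (⟨y, Y y⟩ : TangentBundle I M)) x)
    (hZ : MDifferentiableAt I I.tangent (fun y : M ↦ (⟨y, Z y⟩ : TangentBundle I M)) x)
    (v : TangentSpace I x) :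
    covDerivTwoTensor I (firstFundamentalForm I J φ) Y Z x v =
      inner ℝ (secondFundamentalForm I J φ Y x v) (mfderiv I J φ x (Z x)) +
        inner ℝ (mfderiv I J φ x (Y x)) (secondFundamentalForm I J φ Z x v) := by
  have h1 : covDerivTwoTensor I (firstFundamentalForm I J φ) Y Z x v =
      mvfderiv I (fun y : M ↦
        (inner ℝ (mfderiv I J φ y (Y y)) (mfderiv I J φ y (Z y)) : ℝ)) x v -
      inner ℝ (mfderiv I J φ x (leviCivita I M Y x v)) (mfderiv I J φ x (Z x)) -
      inner ℝ (mfderiv I J φ x (Y x)) (mfderiv I J φ x (leviCivita I M Z x v)) := rfl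
  have h2 (Y : Π x : M, TangentSpace I x) : secondFundamentalForm I J φ Y x v =
      pullbackConnection I J φ (fun y ↦ mfderiv I J φ y (Y y)) x v -
        mfderiv I J φ x (leviCivita I M Y x v) := rfl
  rw [h1, h2, h2, mvfderiv_inner_along I J φ x (hφ.mdifferentiable (by simp) x) _ _
    (mdifferentiableAt_mfderiv_apply I J hφ hY) (mdifferentiableAt_mfderiv_apply I J hφ hZ),
    inner_sub_left, inner_sub_right]
  ring

theorem isTotallyGeodesic_iff_isParallel [I.Boundaryless] {φ : M → N}
    (hφ : IsSmoothSubmersion I J φ) :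
    IsTotallyGeodesic I J φ ↔ IsParallel I (firstFundamentalForm I J φ) := by
  constructor
  · intro h x Y Z hY hZ
    ext v
    rw [covDerivTwoTensor_firstFundamentalForm I J hφ.contMDiff hY hZ, h x Y hY, h x Z hZ]
    simp
  · intro h x Y hY
    have hext (w : TangentSpace I x) := FiberBundle.mdifferentiableAt_extend I E w
    have hcov {Y Z : Π x : M, TangentSpace I x}
        (hY : MDifferentiableAt I I.tangent (fun y : M ↦ (⟨y, Y y⟩ : TangentBundle I M)) x)
        (hZ : MDifferentiableAt I I.tangent (fun y : M ↦ (⟨y, Z y⟩ : TangentBundle I M)) x)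
        (v : TangentSpace I x) :
        (inner ℝ (secondFundamentalForm I J φ Y x v) (mfderiv I J φ x (Z x)) : ℝ) =
          - inner ℝ (secondFundamentalForm I J φ Z x v) (mfderiv I J φ x (Y x)) := by
      have := covDerivTwoTensor_firstFundamentalForm I J hφ.contMDiff hY hZ v
      rw [h x Y Z hY hZ, real_inner_comm _ (mfderiv I J φ x (Y x))] at this
      have h0 : (0 : TangentSpace I x →L[ℝ] ℝ) v = 0 := rfl
      linarith
    let B : TangentSpace I x → TangentSpace I x → TangentSpace J (φ x) := fun v w ↦
      secondFundamentalForm I J φ (FiberBundle.extend E w) x v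
    have hB (v w : TangentSpace I x) : B v w = B w v :=
      secondFundamentalForm_extend_comm I J hφ.contMDiff x v w
    have hskew (v w z : TangentSpace I x) :
        (inner ℝ (B v w) (mfderiv I J φ x z) : ℝ) = - inner ℝ (B v z) (mfderiv I J φ x w) := by
      simpa only [FiberBundle.extend_apply_self] using hcov (hext w) (hext z) v
    -- A trilinear form which is symmetric in two arguments and skew in two others vanishes.
    have hzero (v w : TangentSpace I x) : B v w = 0 := by
      refine ext_inner_right ℝ fun u ↦ ?_
      obtain ⟨z, rfl⟩ := hφ.surjective x u
      have h1 := hskew v w z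
      have h2 := hskew z v w
      have h3 := hskew w z v
      rw [hB w z, hB w v] at h3
      rw [hB v z] at h1
      rw [inner_zero_left]
      linarith
    -- The value at a general `Y` is paired with `dφ z` by exchanging `Y` and the extension of `z`.
    ext v
    refine ext_inner_right ℝ fun u ↦ ?_
    obtain ⟨z, rfl⟩ := hφ.surjective x u
    have h1 := hcov hY (hext z) v
    rw [FiberBundle.extend_apply_self] at h1
    have h2 : secondFundamentalForm I J φ (FiberBundle.extend E z) x v = 0 := hzero v z
    rw [h1, h2]
    simp

end SecondFundamentalForm

/-! ### Eigenvalues and traces of powers -/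

section PowerSums

/-- Two finite families of real numbers with the same power sums are equal up to order: by
linearity they have the same sum `∑ i, p (a i)` for each polynomial `p`, and a polynomial which
vanishes at all values but one detects the multiplicity of that value. -/
theorem card_filter_eq_of_sum_pow_eq {ι : Type*} [Fintype ι] {a b : ι → ℝ}
    (h : ∀ k : ℕ, ∑ i, a i ^ k = ∑ i, b i ^ k) (c : ℝ) :
    (Finset.univ.filter fun i ↦ a i = c).card = (Finset.univ.filter fun i ↦ b i = c).card := by
  classical
  have hpoly (p : Polynomial ℝ) : ∑ i, p.eval (a i) = ∑ i, p.eval (b i) := by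
    simp only [Polynomial.eval_eq_sum_range]
    rw [Finset.sum_comm, Finset.sum_comm (s := Finset.univ)]
    simp only [← Finset.mul_sum, h]
  let S : Finset ℝ := (Finset.univ.image a ∪ Finset.univ.image b).erase c
  let p : Polynomial ℝ := ∏ d ∈ S, (Polynomial.X - Polynomial.C d)
  have hpc : p.eval c ≠ 0 := by
    simp only [p, Polynomial.eval_prod, Polynomial.eval_sub, Polynomial.eval_X,
      Polynomial.eval_C, Finset.prod_ne_zero_iff]
    intro d hd
    exact sub_ne_zero.2 (Finset.ne_of_mem_erase hd).symm
  have hp (u : ι → ℝ) (hu : ∀ i, u i ≠ c → u i ∈ S) :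
      ∑ i, p.eval (u i) = (Finset.univ.filter fun i ↦ u i = c).card * p.eval c := by
    rw [← nsmul_eq_mul, ← Finset.sum_const, Finset.sum_filter]
    refine Finset.sum_congr rfl fun i _ ↦ ?_
    split_ifs with hi
    · rw [hi]
    · simp only [p, Polynomial.eval_prod]
      exact Finset.prod_eq_zero (hu i hi) (by simp)
  have := hpoly p
  rw [hp a fun i hi ↦ Finset.mem_erase.2 ⟨hi, by simp⟩,
    hp b fun i hi ↦ Finset.mem_erase.2 ⟨hi, by simp⟩] at this
  exact_mod_cast mul_right_cancel₀ hpc this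

theorem eq_of_antitone_of_sum_pow_eq {n : ℕ} {a b : Fin n → ℝ} (ha : Antitone a) (hb : Antitone b)
    (h : ∀ k : ℕ, ∑ i, a i ^ k = ∑ i, b i ^ k) : a = b := by
  have hcount := card_filter_eq_of_sum_pow_eq h
  have e (c : ℝ) : {i // a i = c} ≃ {i // b i = c} :=
    Fintype.equivOfCardEq (by rw [Fintype.card_subtype, Fintype.card_subtype, hcount])
  let σ : Equiv.Perm (Fin n) := Equiv.ofFiberEquiv e
  have hσ : b ∘ σ = a := funext fun i ↦ Equiv.ofFiberEquiv_map e i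
  have := Tuple.unique_monotone (α := ℝᵒᵈ) (f := OrderDual.toDual ∘ b) (σ := σ) (τ := 1)
    (fun i j hij ↦ by
      have := ha hij
      rw [← hσ] at this
      exact this)
    (fun i j hij ↦ hb hij)
  rw [← hσ]
  exact this

theorem trace_pow_eq_sum_eigenvalues_pow {V : Type*} [NormedAddCommGroup V]
    [InnerProductSpace ℝ V] [FiniteDimensional ℝ V] {n : ℕ} (hn : Module.finrank ℝ V = n)
    {A : V →ₗ[ℝ] V} (hA : A.IsSymmetric) (k : ℕ) :
    LinearMap.trace ℝ V (A ^ k) = ∑ i, hA.eigenvalues hn i ^ k := by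
  have hpow (i : Fin n) : (A ^ k) (hA.eigenvectorBasis hn i) =
      (hA.eigenvalues hn i) ^ k • hA.eigenvectorBasis hn i := by
    induction k with
    | zero => simp
    | succ k ih =>
      rw [pow_succ, Module.End.mul_apply, hA.apply_eigenvectorBasis, map_smul, ih, smul_smul,
        pow_succ']
      rfl
  rw [LinearMap.trace_eq_sum_inner _ (hA.eigenvectorBasis hn)]
  refine Finset.sum_congr rfl fun i _ ↦ ?_
  rw [hpow, real_inner_smul_right, real_inner_self_eq_norm_sq,
    (hA.eigenvectorBasis hn).orthonormal.1 i]
  simp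

end PowerSums

/-! ### Parallel endomorphisms in a frame -/

section MatrixDerivative

open scoped Matrix.Norms.Operator

variable {n : Type*} [Fintype n]

theorem hasDerivAt_matrix {a : ℝ → Matrix n n ℝ} {a' : Matrix n n ℝ} {r : ℝ}
    (h : ∀ i j, HasDerivAt (fun s ↦ a s i j) (a' i j) r) : HasDerivAt a a' r :=
  hasDerivAt_pi.2 fun i ↦ hasDerivAt_pi.2 fun j ↦ h i j

variable [DecidableEq n]

/-- If `G` and `T` are matrices of two bilinear forms in a frame which are parallel for a connection
with matrix `Γ`, then the endomorphism `a` with `T = G a` is parallel too: `a' = a Γ - Γ a`. -/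
theorem deriv_eq_commutator_of_mul_eq {G T a : ℝ → Matrix n n ℝ} {Γ a' : Matrix n n ℝ} {r : ℝ}
    (hG : HasDerivAt G (Γ.transpose * G r + G r * Γ) r)
    (hT : HasDerivAt T (Γ.transpose * T r + T r * Γ) r)
    (ha : HasDerivAt a a' r)
    (h : ∀ᶠ s in nhds r, G s * a s = T s) (hunit : IsUnit (G r)) :
    a' = a r * Γ - Γ * a r := by
  have h1 := (hG.mul ha).unique (hT.congr_of_eventuallyEq h)
  rw [← h.self_of_nhds] at h1
  refine hunit.mul_left_cancel ?_
  rw [← sub_eq_zero] at h1 ⊢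
  rw [← h1]
  noncomm_ring

theorem hasDerivAt_pow_of_commutator {a : ℝ → Matrix n n ℝ} {Γ : Matrix n n ℝ} {r : ℝ}
    (ha : HasDerivAt a (a r * Γ - Γ * a r) r) (k : ℕ) :
    HasDerivAt (fun s ↦ a s ^ k) (a r ^ k * Γ - Γ * a r ^ k) r := by
  induction k with
  | zero =>
    simp only [pow_zero, one_mul, mul_one, sub_self]
    exact hasDerivAt_const r _
  | succ k ih =>
    simp only [pow_succ]
    refine HasDerivAt.congr_deriv (ih.mul ha) ?_
    noncomm_ring

/-- The traces of the powers of a parallel endomorphism have derivative zero, as they are traces of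
commutators. -/
theorem hasDerivAt_trace_pow_of_commutator {a : ℝ → Matrix n n ℝ} {Γ : Matrix n n ℝ} {r : ℝ}
    (ha : HasDerivAt a (a r * Γ - Γ * a r) r) (k : ℕ) :
    HasDerivAt (fun s ↦ (a s ^ k).trace) 0 r := by
  have h := ((Matrix.traceLinearMap n ℝ ℝ).toContinuousLinearMap.hasFDerivAt
    (x := a r ^ k)).comp_hasDerivAt r (hasDerivAt_pow_of_commutator ha k)
  refine HasDerivAt.congr_deriv h ?_
  change (a r ^ k * Γ - Γ * a r ^ k).trace = 0
  rw [Matrix.trace_sub, Matrix.trace_mul_comm, sub_self]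

theorem exists_hasDerivAt_inv_mul {G T : ℝ → Matrix n n ℝ}
    {G' T' : Matrix n n ℝ} {r : ℝ} (hG : HasDerivAt G G' r) (hT : HasDerivAt T T' r)
    (h : IsUnit (G r)) :
    ∃ a', HasDerivAt (fun s ↦ (G s)⁻¹ * T s) a' r := by
  simp only [Matrix.nonsing_inv_eq_ringInverse]
  obtain ⟨u, hu⟩ := h
  have h1 : DifferentiableAt ℝ (Ring.inverse : Matrix n n ℝ → Matrix n n ℝ) (G r) := by
    rw [← hu]; exact differentiableAt_inverse (𝕜 := ℝ) u.isUnit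
  exact ⟨_, ((DifferentiableAt.comp r h1 hG.differentiableAt).mul hT.differentiableAt).hasDerivAt⟩

end MatrixDerivative

/-! ### Functions constant along curves -/

section Curves

variable {E : Type*} [NormedAddCommGroup E] [NormedSpace ℝ E]
  {H : Type*} [TopologicalSpace H] (I : ModelWithCorners ℝ E H)
  {M : Type*} [TopologicalSpace M] [ChartedSpace H M]

theorem hasDerivAt_comp_curve {V : Type*} [NormedAddCommGroup V] [NormedSpace ℝ V]
    {f : M → V} {γ : ℝ → M} {r : ℝ}
    (hf : MDifferentiableAt I 𝓘(ℝ, V) f (γ r)) (hγ : MDifferentiableAt 𝓘(ℝ) I γ r) :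
    HasDerivAt (fun s ↦ f (γ s)) (mvfderiv I f (γ r) (mfderiv 𝓘(ℝ) I γ r (1 : ℝ))) r := by
  have h := hf.comp r hγ
  have h1 := h.differentiableAt.hasDerivAt
  refine HasDerivAt.congr_deriv h1 ?_
  have h2 := mfderiv_comp_apply r hf hγ (1 : ℝ)
  rw [mfderiv_eq_fderiv] at h2
  exact h2

variable [IsManifold I 1 M] [I.Boundaryless]

/-- A function on a manifold without boundary whose derivative along each differentiable curve
vanishes is locally constant: the points of a small ball in a chart are joined to its centre by
line segments. -/
theorem isLocallyConstant_of_hasDerivAt_curve {f : M → ℝ}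
    (h : ∀ (γ : ℝ → M) (r : ℝ), MDifferentiableAt 𝓘(ℝ) I γ r →
      HasDerivAt (fun s ↦ f (γ s)) 0 r) : IsLocallyConstant f := by
  rw [IsLocallyConstant.iff_eventually_eq]
  intro x
  obtain ⟨ε, hε, hball⟩ := Metric.mem_nhds_iff.1 (extChartAt_target_mem_nhds (I := I) x)
  filter_upwards [(chartAt H x).open_source.mem_nhds (mem_chart_source H x),
    (continuousAt_extChartAt (I := I) x).preimage_mem_nhds (Metric.ball_mem_nhds _ hε)]
    with y hy hyb
  let u : E := extChartAt I x x
  let d : E := extChartAt I x y - u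
  let γ : ℝ → M := fun s ↦ (extChartAt I x).symm (u + s • d)
  have hγ (s : ℝ) (hs : s ∈ Set.Icc (0 : ℝ) 1) : MDifferentiableAt 𝓘(ℝ) I γ s := by
    have hmem : u + s • d ∈ (extChartAt I x).target := by
      refine hball ?_
      rw [Metric.mem_ball, dist_eq_norm, add_sub_cancel_left, norm_smul, Real.norm_eq_abs,
        abs_of_nonneg hs.1]
      have : ‖d‖ < ε := by rwa [Set.mem_preimage, Metric.mem_ball, dist_eq_norm] at hyb
      nlinarith [norm_nonneg d, hs.2]
    have h1 : MDifferentiableAt 𝓘(ℝ, E) I (extChartAt I x).symm (u + s • d) := by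
      have := mdifferentiableWithinAt_extChartAt_symm hmem
      rwa [I.range_eq_univ, mdifferentiableWithinAt_univ] at this
    have h2 : DifferentiableAt ℝ (fun s : ℝ ↦ u + s • d) s := by fun_prop
    exact MDifferentiableAt.comp s h1 h2.mdifferentiableAt
  have h0 : γ 0 = x := by simp [γ, u]
  have h1 : γ 1 = y := by
    simp only [γ, d, one_smul, add_sub_cancel]
    exact (extChartAt I x).left_inv (by simpa using hy)
  have := constant_of_has_deriv_right_zero (f := fun s ↦ f (γ s)) (a := 0) (b := 1)
    (fun s hs ↦ (h γ s (hγ s hs)).continuousAt.continuousWithinAt)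
    (fun s hs ↦ (h γ s (hγ s ⟨hs.1, hs.2.le⟩)).hasDerivWithinAt) 1 (by simp)
  simpa only [h0, h1] using this

end Curves

/-! ### Eigenvalues of a parallel first fundamental form -/

section Traces

variable {E : Type*} [NormedAddCommGroup E] [NormedSpace ℝ E] [FiniteDimensional ℝ E]
  {H : Type*} [TopologicalSpace H] (I : ModelWithCorners ℝ E H)
  {M : Type*} [TopologicalSpace M] [ChartedSpace H M] [IsManifold I ∞ M]
  [RiemannianBundle (fun x : M ↦ TangentSpace I x)]
  {E' : Type*} [NormedAddCommGroup E'] [NormedSpace ℝ E'] [FiniteDimensional ℝ E']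
  {H' : Type*} [TopologicalSpace H'] (J : ModelWithCorners ℝ E' H')
  {N : Type*} [TopologicalSpace N] [ChartedSpace H' N] [IsManifold J ∞ N]
  [RiemannianBundle (fun y : N ↦ TangentSpace J y)]

theorem trace_firstFundamentalEndo_pow (φ : M → N) (x : M) (k : ℕ) :
    LinearMap.trace ℝ (TangentSpace I x) (firstFundamentalEndo I J φ x ^ k) =
      ∑ i, eigenvalues I J φ x i ^ k :=
  trace_pow_eq_sum_eigenvalues_pow (finrank_tangentSpace x)
    (isSymmetric_firstFundamentalEndo I J φ x) k

end Traces

section Parallel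

variable {E : Type*} [NormedAddCommGroup E] [NormedSpace ℝ E] [FiniteDimensional ℝ E]
  {H : Type*} [TopologicalSpace H] (I : ModelWithCorners ℝ E H)
  {M : Type*} [TopologicalSpace M] [ChartedSpace H M] [IsManifold I ∞ M]
  [RiemannianBundle (fun x : M ↦ TangentSpace I x)]
  [IsContMDiffRiemannianBundle I ∞ E (fun x : M ↦ TangentSpace I x)]

/-- The metric is parallel. -/
theorem isParallel_innerSL :
    IsParallel I (fun x : M ↦
      (innerSL ℝ : TangentSpace I x →L[ℝ] TangentSpace I x →L[ℝ] ℝ)) := by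
  intro x Y Z hY hZ
  ext v
  have h := (isMetricCompatible_leviCivita (I := I) (M := M)).mvfderiv_inner_eq
    (FiberBundle.extend E v) hY hZ
  simp only [FiberBundle.extend_apply_self] at h
  have h1 : covDerivTwoTensor I (fun x : M ↦
      (innerSL ℝ : TangentSpace I x →L[ℝ] TangentSpace I x →L[ℝ] ℝ)) Y Z x v =
      mvfderiv I (fun y : M ↦ (inner ℝ (Y y) (Z y) : ℝ)) x v -
      inner ℝ (leviCivita I M Y x v) (Z x) - inner ℝ (Y x) (leviCivita I M Z x v) := rfl
  rw [h1, h]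
  simp

/-- The matrix of a parallel 2-tensor field in a local frame has derivative `Γᵀ T + T Γ` along a
curve, where `Γ` is the matrix of the connection in this frame. -/
theorem hasDerivAt_matrix_of_isParallel {n : Type*} [Fintype n] [DecidableEq n]
    {T : Π x : M, TangentSpace I x →L[ℝ] TangentSpace I x →L[ℝ] ℝ} (hT : IsParallel I T)
    {γ : ℝ → M} {r : ℝ} (hγ : MDifferentiableAt 𝓘(ℝ) I γ r)
    (X : n → Π x : M, TangentSpace I x)
    (hX : ∀ i, MDifferentiableAt I I.tangent (fun y : M ↦ (⟨y, X i y⟩ : TangentBundle I M)) (γ r))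
    (hTX : ∀ i j, MDifferentiableAt I 𝓘(ℝ) (fun y ↦ T y (X i y) (X j y)) (γ r))
    (B : Module.Basis n ℝ (TangentSpace I (γ r))) (hB : ∀ i, B i = X i (γ r)) :
    HasDerivAt (fun s ↦ Matrix.of fun i j ↦ T (γ s) (X i (γ s)) (X j (γ s)))
      ((Matrix.of fun i j ↦
          B.repr (leviCivita I M (X j) (γ r) (mfderiv 𝓘(ℝ) I γ r (1 : ℝ))) i).transpose *
        (Matrix.of fun i j ↦ T (γ r) (X i (γ r)) (X j (γ r))) +
        (Matrix.of fun i j ↦ T (γ r) (X i (γ r)) (X j (γ r))) *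
        (Matrix.of fun i j ↦
          B.repr (leviCivita I M (X j) (γ r) (mfderiv 𝓘(ℝ) I γ r (1 : ℝ))) i)) r := by
  refine hasDerivAt_matrix fun i j ↦ ?_
  have h1 := hasDerivAt_comp_curve I (hTX i j) hγ
  refine HasDerivAt.congr_deriv h1 ?_
  let v : TangentSpace I (γ r) := mfderiv 𝓘(ℝ) I γ r (1 : ℝ)
  have h2 : mvfderiv I (fun y ↦ T y (X i y) (X j y)) (γ r) v -
      T (γ r) (leviCivita I M (X i) (γ r) v) (X j (γ r)) -
      T (γ r) (X i (γ r)) (leviCivita I M (X j) (γ r) v) = 0 :=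
    congrArg (fun A : TangentSpace I (γ r) →L[ℝ] ℝ ↦ A v) (hT (γ r) (X i) (X j) (hX i) (hX j))
  have h3 : mvfderiv I (fun y ↦ T y (X i y) (X j y)) (γ r) v =
      T (γ r) (leviCivita I M (X i) (γ r) v) (X j (γ r)) +
      T (γ r) (X i (γ r)) (leviCivita I M (X j) (γ r) v) := by linarith
  have h4 (u : TangentSpace I (γ r)) : u = ∑ k, B.repr u k • X k (γ r) := by
    simp only [← hB, B.sum_repr]
  refine h3.trans ?_
  rw [Matrix.add_apply, Matrix.mul_apply, Matrix.mul_apply]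
  congr 1
  · conv_lhs => rw [h4 (leviCivita I M (X i) (γ r) v)]
    simp only [map_sum, map_smul, sum_apply, smul_apply, smul_eq_mul]
    rfl
  · conv_lhs => rw [h4 (leviCivita I M (X j) (γ r) v)]
    simp only [map_sum, map_smul, smul_eq_mul]
    exact Finset.sum_congr rfl fun k _ ↦ mul_comm _ _

variable {E' : Type*} [NormedAddCommGroup E'] [NormedSpace ℝ E'] [FiniteDimensional ℝ E']
  {H' : Type*} [TopologicalSpace H'] (J : ModelWithCorners ℝ E' H')
  {N : Type*} [TopologicalSpace N] [ChartedSpace H' N] [IsManifold J ∞ N]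
  [RiemannianBundle (fun y : N ↦ TangentSpace J y)]
  [IsContMDiffRiemannianBundle J ∞ E' (fun y : N ↦ TangentSpace J y)]

/-- If the first fundamental form is parallel, then the traces of the powers of the corresponding
endomorphism have derivative zero along each curve. -/
theorem hasDerivAt_trace_firstFundamentalEndo_pow {φ : M → N} (hφ : ContMDiff I J ∞ φ)
    (h : IsParallel I (firstFundamentalForm I J φ)) (k : ℕ) (γ : ℝ → M) (r : ℝ)
    (hγ : MDifferentiableAt 𝓘(ℝ) I γ r) :
    HasDerivAt (fun s ↦ LinearMap.trace ℝ (TangentSpace I (γ s))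
      (firstFundamentalEndo I J φ (γ s) ^ k)) 0 r := by
  let e := trivializationAt E (TangentSpace I : M → Type _) (γ r)
  have hx : γ r ∈ e.baseSet :=
    FiberBundle.mem_baseSet_trivializationAt E (TangentSpace I : M → Type _) (γ r)
  let b := Module.finBasis ℝ E
  let X := e.localFrame b
  have hX (i) : MDifferentiableAt I I.tangent
      (fun y : M ↦ (⟨y, X i y⟩ : TangentBundle I M)) (γ r) :=
    (contMDiffAt_localFrame_of_mem (I := I) 1 e b i hx).mdifferentiableAt one_ne_zero
  -- `G` and `T` are the matrices of `g` and `φ^* h` in the frame, so `G⁻¹ * T` is the matrix of the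
  -- endomorphism.
  let G : ℝ → Matrix (Fin (Module.finrank ℝ E)) (Fin (Module.finrank ℝ E)) ℝ := fun s ↦
    Matrix.of fun i j ↦ inner ℝ (X i (γ s)) (X j (γ s))
  let T : ℝ → Matrix (Fin (Module.finrank ℝ E)) (Fin (Module.finrank ℝ E)) ℝ := fun s ↦
    Matrix.of fun i j ↦ firstFundamentalForm I J φ (γ s) (X i (γ s)) (X j (γ s))
  have hframe {y : M} (hy : y ∈ e.baseSet) (i) : e.basisAt b hy i = X i y :=
    (e.localFrame_apply_of_mem_baseSet b hy).symm
  have hG := hasDerivAt_matrix_of_isParallel I (isParallel_innerSL I) hγ X hX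
    (fun i j ↦ MDifferentiableAt.inner_bundle (IB := I) (F := E)
      (E := fun x : M ↦ TangentSpace I x) (b := id) (hX i) (hX j))
    (e.basisAt b hx) (hframe hx)
  have hT := hasDerivAt_matrix_of_isParallel I h hγ X hX
    (fun i j ↦ MDifferentiableAt.inner_bundle (IB := J) (F := E')
      (E := fun x : N ↦ TangentSpace J x) (b := φ) (mdifferentiableAt_mfderiv_apply I J hφ (hX i))
      (mdifferentiableAt_mfderiv_apply I J hφ (hX j)))
    (e.basisAt b hx) (hframe hx)
  have hunit {s : ℝ} (hs : γ s ∈ e.baseSet) : IsUnit (G s) := by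
    have hli : LinearIndependent ℝ (fun i ↦ X i (γ s)) := by
      have := (e.basisAt b hs).linearIndependent
      rwa [show ⇑(e.basisAt b hs) = fun i ↦ X i (γ s) from funext (hframe hs)] at this
    exact (Matrix.posDef_gram_of_linearIndependent hli).isUnit
  have hev : ∀ᶠ s in nhds r, γ s ∈ e.baseSet :=
    hγ.continuousAt.preimage_mem_nhds (e.open_baseSet.mem_nhds hx)
  obtain ⟨a', ha⟩ := exists_hasDerivAt_inv_mul hG hT (hunit hx)
  have hGa : ∀ᶠ s in nhds r, G s * ((G s)⁻¹ * T s) = T s := by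
    filter_upwards [hev] with s hs
    rw [← mul_assoc, Matrix.mul_nonsing_inv _ ((Matrix.isUnit_iff_isUnit_det _).1 (hunit hs)),
      one_mul]
  have hcomm := deriv_eq_commutator_of_mul_eq hG hT ha hGa (hunit hx)
  rw [hcomm] at ha
  refine HasDerivAt.congr_of_eventuallyEq (hasDerivAt_trace_pow_of_commutator ha k) ?_
  filter_upwards [hev] with s hs
  let B := e.basisAt b hs
  have hmat : LinearMap.toMatrix B B (firstFundamentalEndo I J φ (γ s)) = (G s)⁻¹ * T s := by
    have h1 : G s * LinearMap.toMatrix B B (firstFundamentalEndo I J φ (γ s)) = T s := by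
      ext i j
      have h2 : firstFundamentalEndo I J φ (γ s) (B j) =
          ∑ k, LinearMap.toMatrix B B (firstFundamentalEndo I J φ (γ s)) k j • B k := by
        simp only [LinearMap.toMatrix_apply, B.sum_repr]
      have h3 : T s i j = inner ℝ (B i) (firstFundamentalEndo I J φ (γ s) (B j)) := by
        rw [← isSymmetric_firstFundamentalEndo, inner_firstFundamentalEndo, hframe, hframe]
        rfl
      rw [h3, h2, inner_sum, Matrix.mul_apply]
      refine Finset.sum_congr rfl fun k _ ↦ ?_
      rw [real_inner_smul_right, mul_comm, hframe, hframe]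
      rfl
    rw [← h1, ← mul_assoc, Matrix.nonsing_inv_mul _
      ((Matrix.isUnit_iff_isUnit_det _).1 (hunit hs)), one_mul]
  rw [LinearMap.trace_eq_matrix_trace ℝ B, ← LinearMap.toMatrix_pow]
  exact congrArg (fun a ↦ (a ^ k).trace) hmat

/-- The eigenvalues of a parallel first fundamental form are constant on connected components. -/
theorem eigenvalues_eq_of_isParallel [I.Boundaryless] {φ : M → N} (hφ : ContMDiff I J ∞ φ)
    (h : IsParallel I (firstFundamentalForm I J φ)) {x y : M} (hxy : y ∈ connectedComponent x) :
    eigenvalues I J φ y = eigenvalues I J φ x := by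
  have hanti (z : M) : Antitone (eigenvalues I J φ z) :=
    (isSymmetric_firstFundamentalEndo I J φ z).eigenvalues_antitone _
  refine eq_of_antitone_of_sum_pow_eq (hanti y) (hanti x) fun k ↦ ?_
  rw [← trace_firstFundamentalEndo_pow, ← trace_firstFundamentalEndo_pow]
  exact (isLocallyConstant_of_hasDerivAt_curve I
    (f := fun z ↦ LinearMap.trace ℝ (TangentSpace I z) (firstFundamentalEndo I J φ z ^ k))
    (hasDerivAt_trace_firstFundamentalEndo_pow I J hφ h k)).apply_eq_of_isPreconnected
    isPreconnected_connectedComponent hxy mem_connectedComponent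

end Parallel

end RiemannianMaps

theorem mainTheorem7
    {E : Type*} [NormedAddCommGroup E] [NormedSpace ℝ E] [FiniteDimensional ℝ E]
    {H : Type*} [TopologicalSpace H] (I : ModelWithCorners ℝ E H) [I.Boundaryless]
    {M : Type*} [TopologicalSpace M] [ChartedSpace H M] [IsManifold I ∞ M]
    [RiemannianBundle (fun x : M ↦ TangentSpace I x)]
    [IsContMDiffRiemannianBundle I ∞ E (fun x : M ↦ TangentSpace I x)]
    {E' : Type*} [NormedAddCommGroup E'] [NormedSpace ℝ E'] [FiniteDimensional ℝ E']
    {H' : Type*} [TopologicalSpace H'] (J : ModelWithCorners ℝ E' H') [J.Boundaryless]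
    {N : Type*} [TopologicalSpace N] [ChartedSpace H' N] [IsManifold J ∞ N]
    [RiemannianBundle (fun y : N ↦ TangentSpace J y)]
    [IsContMDiffRiemannianBundle J ∞ E' (fun y : N ↦ TangentSpace J y)]
    (φ : M → N) (hφ : RiemannianMaps.IsSmoothSubmersion I J φ) :
    (RiemannianMaps.IsTotallyGeodesic I J φ ↔
      RiemannianMaps.IsParallel I (RiemannianMaps.firstFundamentalForm I J φ)) ∧
    (RiemannianMaps.IsTotallyGeodesic I J φ →
      ∀ (i : Fin (Module.finrank ℝ E)) (x y : M), y ∈ connectedComponent x →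
        RiemannianMaps.eigenvalues I J φ y i = RiemannianMaps.eigenvalues I J φ x i) := by
  refine ⟨RiemannianMaps.isTotallyGeodesic_iff_isParallel I J hφ, fun h i x y hxy ↦ ?_⟩
  exact congrFun (RiemannianMaps.eigenvalues_eq_of_isParallel I J hφ.contMDiff
    ((RiemannianMaps.isTotallyGeodesic_iff_isParallel I J hφ).1 h) hxy) i
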